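/- Let $k$ be a field. A Poisson algebra over $k$ is a commutative associative unital $k$-algebra with a $k$-bilinear Lie bracket $[\cdot,\cdot]$ satisfying $[a,bc]=b[a,c]+c[a,b]$. Let $P_3$ be the free Poisson algebra over $k$ on $x_1,x_2,x_3$, let $C_3=k[x_1,x_2,x_3]$ be the polynomial algebra with zero bracket, and let $\pi:P_3\to C_3$ be the homomorphism of Poisson algebras with $\pi(x_i)=x_i$. For $A=P_3$ or $A=C_3$, an elementary automorphism of $A$ is an automorphism of the Poisson algebra $A$ of the form $x_i\mapsto \alpha x_i+f$, $x_j\mapsto x_j$ $(j\neq i)$, where $i\in\{1,2,3\}$, $0\ne\alpha\in k$, and $f$ lies in the (unital) Poisson subalgebra generated by the $x_j$ with $j\neq i$. An automorphism of $A$ is tame if it lies in the subgroup of $\mathrm{Aut}(A)$ generated by the elementary automorphisms, and wild otherwise. Theorem. The Poisson algebra endomorphism $\delta$ of $P_3$ given by $$\delta(x_1)=x_1+[x_3,\,x_1x_3-[x_3,x_2]],\qquad \delta(x_2)=x_2+(x_1x_3-[x_3,x_2])x_3,\qquad \delta(x_3)=x_3$$ is an automorphism of $P_3$, and it is wild. Moreover,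 the automorphism $\bar\delta$ of $C_3$ with $x_1\mapsto x_1$, $x_2\mapsto x_2+x_1x_3^2$, $x_3\mapsto x_3$ is tame and satisfies $\pi\circ\delta=\bar\delta\circ\pi$. -/

import Mathlib

/-- A (commutative, unital) Poisson algebra over `k`: a commutative associative unital
`k`-algebra with a bilinear bracket that is a Lie bracket and satisfies the Leibniz identity. -/
class PoissonAlgebra (k : Type*) (A : Type*) [CommRing k] [CommRing A] [Algebra k A] where
  bracket : A →ₗ[k] A →ₗ[k] A
  bracket_self : ∀ a, bracket a a = 0
  jacobi : ∀ a b c,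
    bracket a (bracket b c) + bracket b (bracket c a) + bracket c (bracket a b) = 0
  leibniz : ∀ a b c, bracket a (b * c) = b * bracket a c + c * bracket a b

namespace PoissonAlgebra

/-- Homomorphisms of Poisson algebras. -/
structure Hom (k A B : Type*) [CommRing k] [CommRing A] [Algebra k A] [PoissonAlgebra k A]
    [CommRing B] [Algebra k B] [PoissonAlgebra k B] extends A →ₐ[k] B where
  map_bracket' : ∀ a b, toFun (bracket (k := k) a b) = bracket (k := k) (toFun a) (toFun b)

section Aut

variable (k : Type*) {A ι : Type*} [Field k] [CommRing A] [Algebra k A] [PoissonAlgebra k A]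

variable (A) in
/-- The group of automorphisms of a Poisson algebra, as a subgroup of the group of its
automorphisms as an associative algebra. -/
def Aut : Subgroup (A ≃ₐ[k] A) where
  carrier := {φ | ∀ a b, φ (bracket (k := k) a b) = bracket (k := k) (φ a) (φ b)}
  one_mem' := fun _ _ => rfl
  mul_mem' := by
    intro φ ψ hφ hψ a b
    have h1 := hψ a b
    have h2 := hφ (ψ a) (ψ b)
    simp only [AlgEquiv.mul_apply]
    rw [h1, h2]
  inv_mem' := by
    intro φ hφ a b
    have h := hφ (φ.symm a) (φ.symm b)
    simp only [AlgEquiv.apply_symm_apply] at h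
    change φ.symm _ = bracket (φ.symm a) (φ.symm b)
    rw [← h, AlgEquiv.symm_apply_apply]

/-- The Poisson subalgebra generated by a set: the smallest unital subalgebra that contains the
set and is closed under the bracket. -/
def adjoin (s : Set A) : Subalgebra k A :=
  sInf {S | s ⊆ S ∧ ∀ a ∈ S, ∀ b ∈ S, bracket (k := k) a b ∈ S}

/-- Elementary automorphisms with respect to the family of generators `x`:
`x i ↦ α x i + f`, `x j ↦ x j` for `j ≠ i`, where `α` is a nonzero scalar and `f` lies in the
Poisson subalgebra generated by the `x j` with `j ≠ i`. -/
def IsElementary (x : ι → A) (φ : Aut k A) : Prop :=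
  ∃ (i : ι) (α : k) (f : A), α ≠ 0 ∧ f ∈ adjoin k (x '' {j | j ≠ i}) ∧
    φ.1 (x i) = α • x i + f ∧ ∀ j, j ≠ i → φ.1 (x j) = x j

/-- The group of tame automorphisms with respect to the family of generators `x`. -/
def tameAut (x : ι → A) : Subgroup (Aut k A) :=
  Subgroup.closure {φ | IsElementary k x φ}

/-- Wild automorphisms are those that are not tame. -/
def IsWild (x : ι → A) (φ : Aut k A) : Prop := φ ∉ tameAut k x

end Aut

end PoissonAlgebra

/-- Polynomial algebras carry the trivial Poisson bracket. -/
noncomputable instance MvPolynomial.trivialPoisson (k σ : Type*) [CommRing k] :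
    PoissonAlgebra k (MvPolynomial σ k) where
  bracket := 0
  bracket_self _ := rfl
  jacobi _ _ _ := by simp
  leibniz _ _ _ := by simp

/-! The free Poisson algebra: formal expressions modulo the Poisson algebra identities. -/

namespace FreePoisson

/-- Formal expressions in the generators, the scalars, sums, products and brackets. -/
inductive Pre (k X : Type*)
  | of : X → Pre k X
  | scalar : k → Pre k X
  | add : Pre k X → Pre k X → Pre k X
  | mul : Pre k X → Pre k X → Pre k X
  | br : Pre k X → Pre k X → Pre k X

open Pre in
/-- The congruence on formal expressions is generated by this relation. -/
inductive Rel (k X : Type*) [CommRing k] : Pre k X → Pre k X → Prop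
  | add_scalar (r s : k) : Rel k X (scalar (r + s)) (add (scalar r) (scalar s))
  | mul_scalar (r s : k) : Rel k X (scalar (r * s)) (mul (scalar r) (scalar s))
  | add_assoc (a b c) : Rel k X (add (add a b) c) (add a (add b c))
  | add_comm (a b) : Rel k X (add a b) (add b a)
  | zero_add (a) : Rel k X (add (scalar 0) a) a
  | mul_assoc (a b c) : Rel k X (mul (mul a b) c) (mul a (mul b c))
  | mul_comm (a b) : Rel k X (mul a b) (mul b a)
  | one_mul (a) : Rel k X (mul (scalar 1) a) a
  | zero_mul (a) : Rel k X (mul (scalar 0) a) (scalar 0)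
  | mul_add (a b c) : Rel k X (mul a (add b c)) (add (mul a b) (mul a c))
  | br_add (a b c) : Rel k X (br a (add b c)) (add (br a b) (br a c))
  | add_br (a b c) : Rel k X (br (add a b) c) (add (br a c) (br b c))
  | br_smul (r : k) (a b) : Rel k X (br a (mul (scalar r) b)) (mul (scalar r) (br a b))
  | smul_br (r : k) (a b) : Rel k X (br (mul (scalar r) a) b) (mul (scalar r) (br a b))
  | br_self (a) : Rel k X (br a a) (scalar 0)
  | jacobi (a b c) :
      Rel k X (add (add (br a (br b c)) (br b (br c a))) (br c (br a b))) (scalar 0)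
  | leibniz (a b c) : Rel k X (br a (mul b c)) (add (mul b (br a c)) (mul c (br a b)))
  | add_left {a b} (c) : Rel k X a b → Rel k X (add a c) (add b c)
  | add_right (c) {a b} : Rel k X a b → Rel k X (add c a) (add c b)
  | mul_left {a b} (c) : Rel k X a b → Rel k X (mul a c) (mul b c)
  | mul_right (c) {a b} : Rel k X a b → Rel k X (mul c a) (mul c b)
  | br_left {a b} (c) : Rel k X a b → Rel k X (br a c) (br b c)
  | br_right (c) {a b} : Rel k X a b → Rel k X (br c a) (br c b)

end FreePoisson

/-- The free (unital) Poisson algebra over `k` on the set `X`. -/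
def FreePoissonAlgebra (k X : Type*) [CommRing k] : Type _ := Quot (FreePoisson.Rel k X)

namespace FreePoissonAlgebra

open FreePoisson

section Structure

variable (k : Type*) {X : Type*} [CommRing k]

/-- The class of a formal expression. -/
def mk (a : Pre k X) : FreePoissonAlgebra k X := Quot.mk _ a

/-- The free generators. -/
def ι (x : X) : FreePoissonAlgebra k X := mk k (Pre.of x)

/-- Addition. -/
def addAux : FreePoissonAlgebra k X → FreePoissonAlgebra k X → FreePoissonAlgebra k X :=
  Quot.map₂ Pre.add (fun c _ _ h => Rel.add_right c h) (fun _ _ c h => Rel.add_left c h)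

/-- Multiplication. -/
def mulAux : FreePoissonAlgebra k X → FreePoissonAlgebra k X → FreePoissonAlgebra k X :=
  Quot.map₂ Pre.mul (fun c _ _ h => Rel.mul_right c h) (fun _ _ c h => Rel.mul_left c h)

/-- The bracket. -/
def brAux : FreePoissonAlgebra k X → FreePoissonAlgebra k X → FreePoissonAlgebra k X :=
  Quot.map₂ Pre.br (fun c _ _ h => Rel.br_right c h) (fun _ _ c h => Rel.br_left c h)

instance instCommRing : CommRing (FreePoissonAlgebra k X) where
  add := addAux k
  mul := mulAux k
  zero := mk k (Pre.scalar 0)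
  one := mk k (Pre.scalar 1)
  neg := mulAux k (mk k (Pre.scalar (-1)))
  add_assoc := by rintro ⟨a⟩ ⟨b⟩ ⟨c⟩; exact Quot.sound (Rel.add_assoc a b c)
  add_comm := by rintro ⟨a⟩ ⟨b⟩; exact Quot.sound (Rel.add_comm a b)
  zero_add := by rintro ⟨a⟩; exact Quot.sound (Rel.zero_add a)
  add_zero := by
    rintro ⟨a⟩
    exact (Quot.sound (Rel.add_comm a _)).trans (Quot.sound (Rel.zero_add a))
  mul_assoc := by rintro ⟨a⟩ ⟨b⟩ ⟨c⟩; exact Quot.sound (Rel.mul_assoc a b c)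
  mul_comm := by rintro ⟨a⟩ ⟨b⟩; exact Quot.sound (Rel.mul_comm a b)
  one_mul := by rintro ⟨a⟩; exact Quot.sound (Rel.one_mul a)
  mul_one := by
    rintro ⟨a⟩
    exact (Quot.sound (Rel.mul_comm a _)).trans (Quot.sound (Rel.one_mul a))
  zero_mul := by rintro ⟨a⟩; exact Quot.sound (Rel.zero_mul a)
  mul_zero := by
    rintro ⟨a⟩
    exact (Quot.sound (Rel.mul_comm a _)).trans (Quot.sound (Rel.zero_mul a))
  left_distrib := by rintro ⟨a⟩ ⟨b⟩ ⟨c⟩; exact Quot.sound (Rel.mul_add a b c)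
  right_distrib := by
    rintro ⟨a⟩ ⟨b⟩ ⟨c⟩
    refine (Quot.sound (Rel.mul_comm _ c)).trans ((Quot.sound (Rel.mul_add c a b)).trans ?_)
    exact (Quot.sound (Rel.add_left _ (Rel.mul_comm c a))).trans
      (Quot.sound (Rel.add_right _ (Rel.mul_comm c b)))
  neg_add_cancel := by
    rintro ⟨a⟩
    have h1 : mk k (Pre.add (Pre.mul (Pre.scalar (-1)) a) a)
        = mk k (Pre.mul a (Pre.add (Pre.scalar (-1)) (Pre.scalar 1))) := by
      refine (Quot.sound (Rel.add_left _ (Rel.mul_comm _ a))).trans ?_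
      refine (Quot.sound (Rel.add_right _ (Rel.one_mul a))).symm.trans ?_
      refine (Quot.sound (Rel.add_right _ (Rel.mul_comm _ a))).trans ?_
      exact (Quot.sound (Rel.mul_add a _ _)).symm
    have h2 : mk k (Pre.mul a (Pre.add (Pre.scalar (-1)) (Pre.scalar 1)))
        = mk k (Pre.scalar 0 : Pre k X) := by
      refine (Quot.sound (Rel.mul_right a (Rel.add_scalar (-1) 1))).symm.trans ?_
      rw [neg_add_cancel]
      exact (Quot.sound (Rel.mul_comm a _)).trans (Quot.sound (Rel.zero_mul a))
    exact h1.trans h2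
  nsmul := @nsmulRec _ ⟨mk k (Pre.scalar 0)⟩ ⟨addAux k⟩
  zsmul := @zsmulRec _ ⟨mk k (Pre.scalar 0)⟩ ⟨addAux k⟩ ⟨mulAux k (mk k (Pre.scalar (-1)))⟩
    (@nsmulRec _ ⟨mk k (Pre.scalar 0)⟩ ⟨addAux k⟩)

instance instAlgebra : Algebra k (FreePoissonAlgebra k X) where
  smul r a := mk k (Pre.scalar r) * a
  algebraMap :=
    { toFun := fun r => mk k (Pre.scalar r)
      map_one' := rfl
      map_mul' := fun r s => Quot.sound (Rel.mul_scalar r s)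
      map_zero' := rfl
      map_add' := fun r s => Quot.sound (Rel.add_scalar r s) }
  commutes' _ _ := mul_comm _ _
  smul_def' _ _ := rfl

instance instPoisson : PoissonAlgebra k (FreePoissonAlgebra k X) where
  bracket := LinearMap.mk₂ k (brAux k)
    (by rintro ⟨a⟩ ⟨b⟩ ⟨c⟩; exact Quot.sound (Rel.add_br a b c))
    (by rintro r ⟨a⟩ ⟨b⟩; exact Quot.sound (Rel.smul_br r a b))
    (by rintro ⟨a⟩ ⟨b⟩ ⟨c⟩; exact Quot.sound (Rel.br_add a b c))
    (by rintro r ⟨a⟩ ⟨b⟩; exact Quot.sound (Rel.br_smul r a b))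
  bracket_self := by rintro ⟨a⟩; exact Quot.sound (Rel.br_self a)
  jacobi := by rintro ⟨a⟩ ⟨b⟩ ⟨c⟩; exact Quot.sound (Rel.jacobi a b c)
  leibniz := by rintro ⟨a⟩ ⟨b⟩ ⟨c⟩; exact Quot.sound (Rel.leibniz a b c)

end Structure

section Lift

variable {k X A : Type*} [CommRing k] [CommRing A] [Algebra k A] [PoissonAlgebra k A]

/-- Evaluation of formal expressions. -/
def evalPre (f : X → A) : Pre k X → A
  | .of x => f x
  | .scalar r => algebraMap k A r
  | .add a b => evalPre f a + evalPre f b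
  | .mul a b => evalPre f a * evalPre f b
  | .br a b => PoissonAlgebra.bracket (k := k) (evalPre f a) (evalPre f b)

theorem evalPre_rel (f : X → A) {a b : Pre k X} (h : Rel k X a b) :
    evalPre f a = evalPre f b := by
  induction h with
  | add_scalar r s => simp [evalPre]
  | mul_scalar r s => simp [evalPre]
  | add_assoc a b c => simp only [evalPre]; ring
  | add_comm a b => simp only [evalPre]; ring
  | zero_add a => simp [evalPre]
  | mul_assoc a b c => simp only [evalPre]; ring
  | mul_comm a b => simp only [evalPre]; ring
  | one_mul a => simp [evalPre]
  | zero_mul a => simp [evalPre]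
  | mul_add a b c => simp only [evalPre]; ring
  | br_add a b c => simp [evalPre]
  | add_br a b c => simp [evalPre]
  | br_smul r a b => simp [evalPre, ← Algebra.smul_def]
  | smul_br r a b => simp [evalPre, ← Algebra.smul_def]
  | br_self a => simp [evalPre, PoissonAlgebra.bracket_self]
  | jacobi a b c => simp [evalPre, PoissonAlgebra.jacobi]
  | leibniz a b c => simp [evalPre, PoissonAlgebra.leibniz]
  | add_left c _ ih => simp [evalPre, ih]
  | add_right c _ ih => simp [evalPre, ih]
  | mul_left c _ ih => simp [evalPre, ih]
  | mul_right c _ ih => simp [evalPre, ih]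
  | br_left c _ ih => simp [evalPre, ih]
  | br_right c _ ih => simp [evalPre, ih]

/-- The Poisson algebra homomorphism with prescribed values on the free generators. -/
def lift (f : X → A) : PoissonAlgebra.Hom k (FreePoissonAlgebra k X) A where
  toFun := Quot.lift (evalPre f) (fun _ _ h => evalPre_rel f h)
  map_one' := map_one (algebraMap k A)
  map_mul' := by rintro ⟨a⟩ ⟨b⟩; rfl
  map_zero' := map_zero (algebraMap k A)
  map_add' := by rintro ⟨a⟩ ⟨b⟩; rfl
  commutes' _ := rfl
  map_bracket' := by rintro ⟨a⟩ ⟨b⟩; rfl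

theorem lift_ι (f : X → A) (x : X) : (lift (k := k) f).toAlgHom (ι k x) = f x := rfl

/-- Uniqueness in the universal property of the free Poisson algebra. -/
theorem hom_ext (φ ψ : PoissonAlgebra.Hom k (FreePoissonAlgebra k X) A)
    (h : ∀ x, φ.toAlgHom (ι k x) = ψ.toAlgHom (ι k x)) (a : FreePoissonAlgebra k X) :
    φ.toAlgHom a = ψ.toAlgHom a := by
  obtain ⟨a⟩ := a
  induction a with
  | of x => exact h x
  | scalar r => exact (φ.toAlgHom.commutes r).trans (ψ.toAlgHom.commutes r).symm
  | add a b iha ihb =>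
    change φ.toAlgHom (mk k a + mk k b) = ψ.toAlgHom (mk k a + mk k b)
    rw [map_add, map_add]
    exact congrArg₂ (· + ·) iha ihb
  | mul a b iha ihb =>
    change φ.toAlgHom (mk k a * mk k b) = ψ.toAlgHom (mk k a * mk k b)
    rw [map_mul, map_mul]
    exact congrArg₂ (· * ·) iha ihb
  | br a b iha ihb =>
    exact (φ.map_bracket' (mk k a) (mk k b)).trans
      ((congrArg₂ (fun u v => PoissonAlgebra.bracket (k := k) u v) iha ihb).trans
        (ψ.map_bracket' (mk k a) (mk k b)).symm)

end Lift

/-- The Poisson algebra homomorphism from the free Poisson algebra to the polynomial algebra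
(with trivial bracket) that sends generators to variables. -/
noncomputable def toPoly (k X : Type*) [CommRing k] :
    PoissonAlgebra.Hom k (FreePoissonAlgebra k X) (MvPolynomial X k) :=
  lift MvPolynomial.X

/-- The element `x₁x₃ - [x₃, x₂]` (generators are numbered `0, 1, 2`). -/
def anickElt (k : Type*) [CommRing k] : FreePoissonAlgebra k (Fin 3) :=
  ι k 0 * ι k 2 - PoissonAlgebra.bracket (k := k) (ι k 2) (ι k 1)

/-- The Anick type endomorphism
`(x₁ + [x₃, x₁x₃ - [x₃, x₂]], x₂ + (x₁x₃ - [x₃, x₂])x₃, x₃)`. -/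
def anick (k : Type*) [CommRing k] :
    PoissonAlgebra.Hom k (FreePoissonAlgebra k (Fin 3)) (FreePoissonAlgebra k (Fin 3)) :=
  lift ![ι k 0 + PoissonAlgebra.bracket (k := k) (ι k 2) (anickElt k),
    ι k 1 + anickElt k * ι k 2,
    ι k 2]

end FreePoissonAlgebra

/-! Put w = x₀x₂ − [x₂, x₁]. The endomorphism δ fixes w, so reversing the signs of its correction
terms inverts it. The polynomial map it induces is itself elementary. The real content is wildness,
which is detected by 2 × 2 matrices.

`Jet` extends C = k[x₀, x₁, x₂] by a square zero ideal, free over C[s] on e₀, e₁, with [x₂, xᵢ] =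
[x₂, eᵢ] = s eᵢ for i < 2. An automorphism κ of P₃ that is trivial modulo brackets corresponds under
`toJet` to the endomorphism xⱼ ↦ xⱼ + gⱼ, eⱼ ↦ eⱼ + gⱼ, so `jetMatrix` is multiplicative on such κ.
A general φ is brought to this form by splitting off the lift of its polynomial part
(`bracketPart`), which is multiplicative up to a twist γ.

For elementary φ the matrix is 1 + F vᵀ with v · F = 0 and s ∣ F
(`matPolyEquiv_jetMatrix_mem_of_isElementary`). Hence a tame φ gives a product of letters 1 + H,
each H nilpotent in some direction. Neighbouring letters of equal direction merge, and in the
resulting reduced product the degrees in s add up, because the leading coefficients have nonzero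
product (`leadingCoeff_mul_ne_zero`).

With a = x₂, δ has the matrix (1 + as, −a³s; −s², 1 − as + a²s²), of degree 2 in s. As a reduced
product it would have at most two letters. One letter is impossible since the coefficient of s has
nonzero determinant; two letters would make a a unit (`ne_cohn`). -/

/-! ### Nilpotent letters -/

open Polynomial in
/-- Polynomials `H` over `2 × 2` matrices, without constant term, all of whose coefficients are
multiples of the nilpotent matrix with image and kernel spanned by `(-v₁, v₀)`. -/
structure IsNilpotentLetter {R : Type*} [CommRing R] (v : Fin 2 → R)
    (H : (Matrix (Fin 2) (Fin 2) R)[X]) : Prop where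
  coeff_zero : H.coeff 0 = 0
  left : ∀ n j, v 0 * H.coeff n 0 j + v 1 * H.coeff n 1 j = 0
  right : ∀ n i, v 1 * H.coeff n i 0 = v 0 * H.coeff n i 1

namespace IsNilpotentLetter

open Polynomial Matrix

variable {R : Type*} [CommRing R] {v w : Fin 2 → R} {H K : (Matrix (Fin 2) (Fin 2) R)[X]}

theorem neg (h : IsNilpotentLetter v H) : IsNilpotentLetter v (-H) where
  coeff_zero := by simp [h.coeff_zero]
  left n j := by
    have := h.left n j
    simp only [coeff_neg, Matrix.neg_apply]
    linear_combination -this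
  right n i := by
    have := h.right n i
    simp only [coeff_neg, Matrix.neg_apply]
    linear_combination -this

theorem add (h : IsNilpotentLetter v H) (h' : IsNilpotentLetter v K) :
    IsNilpotentLetter v (H + K) where
  coeff_zero := by simp [h.coeff_zero, h'.coeff_zero]
  left n j := by
    simp only [coeff_add, Matrix.add_apply]
    linear_combination h.left n j + h'.left n j
  right n i := by
    simp only [coeff_add, Matrix.add_apply]
    linear_combination h.right n i + h'.right n i

theorem natDegree_pos (h : IsNilpotentLetter v H) (hH : H ≠ 0) : 0 < H.natDegree := by
  by_contra h0
  rw [not_lt, Nat.le_zero] at h0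
  rw [eq_C_of_natDegree_eq_zero h0, h.coeff_zero, map_zero] at hH
  exact hH rfl

theorem natDegree_one_add (h : IsNilpotentLetter v H) (hH : H ≠ 0) :
    (1 + H).natDegree = H.natDegree :=
  natDegree_add_eq_right_of_natDegree_lt (by
    rw [natDegree_one]; exact h.natDegree_pos hH)

variable [IsDomain R]

theorem leadingCoeff_one_add (h : IsNilpotentLetter v H) (hH : H ≠ 0) :
    (1 + H).leadingCoeff = H.leadingCoeff :=
  leadingCoeff_add_of_degree_lt (by
    rw [degree_one, ← natDegree_pos_iff_degree_pos]; exact h.natDegree_pos hH)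

/-- Only the line through v matters: over a domain a nonzero coordinate of v can be cancelled. -/
theorem congr (hv : v ≠ 0) (hvw : v 0 * w 1 = v 1 * w 0) (h : IsNilpotentLetter v H) :
    IsNilpotentLetter w H where
  coeff_zero := h.coeff_zero
  left n j := by
    have h1 := h.left n j
    by_cases h0 : v 0 = 0
    · have hv1 : v 1 ≠ 0 := fun h1 => hv (by ext i; fin_cases i <;> assumption)
      refine mul_left_cancel₀ hv1 ?_
      linear_combination w 1 * h1 - H.coeff n 0 j * hvw
    · refine mul_left_cancel₀ h0 ?_
      linear_combination w 0 * h1 + H.coeff n 1 j * hvw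
  right n i := by
    have h1 := h.right n i
    by_cases h0 : v 0 = 0
    · have hv1 : v 1 ≠ 0 := fun h1 => hv (by ext i; fin_cases i <;> assumption)
      refine mul_left_cancel₀ hv1 ?_
      linear_combination w 1 * h1 + H.coeff n i 1 * hvw
    · refine mul_left_cancel₀ h0 ?_
      linear_combination w 0 * h1 + H.coeff n i 0 * hvw

/-- The rows of the coefficients of `H` are parallel to v, and the columns of those of `K` are
orthogonal to v. -/
theorem mul_eq_zero (hv : v ≠ 0) (h : IsNilpotentLetter v H) (h' : IsNilpotentLetter v K) :
    H * K = 0 := by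
  refine Polynomial.ext fun n => ?_
  rw [coeff_mul, Polynomial.coeff_zero]
  refine Finset.sum_eq_zero fun p _ => ?_
  ext i j
  rw [Matrix.mul_apply, Fin.sum_univ_two, Matrix.zero_apply]
  have h1 := h.right p.1 i
  have h2 := h'.left p.2 j
  by_cases h0 : v 0 = 0
  · have hv1 : v 1 ≠ 0 := fun h1 => hv (by ext i; fin_cases i <;> assumption)
    refine mul_left_cancel₀ hv1 ?_
    linear_combination K.coeff p.2 0 j * h1 + H.coeff p.1 i 1 * h2
  · refine mul_left_cancel₀ h0 ?_
    linear_combination -K.coeff p.2 1 j * h1 + H.coeff p.1 i 0 * h2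

end IsNilpotentLetter

/-! ### Reduced products of letters and their degrees -/

open Polynomial in
/-- Products of factors `1 + H`, with nilpotent letters `H ≠ 0` such that neighbouring letters have
non-proportional directions, indexed by the direction of the first factor. -/
inductive IsReducedProduct {R : Type*} [CommRing R] :
    (Fin 2 → R) → (Matrix (Fin 2) (Fin 2) R)[X] → Prop
  | single {v H} : v ≠ 0 → IsNilpotentLetter v H → H ≠ 0 → IsReducedProduct v (1 + H)
  | cons {v w H M} : v ≠ 0 → IsNilpotentLetter v H → H ≠ 0 → v 0 * w 1 ≠ v 1 * w 0 →
      IsReducedProduct w M → IsReducedProduct v ((1 + H) * M)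

namespace IsReducedProduct

open Polynomial Matrix

variable {R : Type*} [CommRing R] {v : Fin 2 → R} {M : (Matrix (Fin 2) (Fin 2) R)[X]}

theorem ne_zero (h : IsReducedProduct v M) : v ≠ 0 := by
  cases h <;> assumption

variable [IsDomain R]

/-- Multiplication by a letter keeps the products that are reduced or trivial. -/
theorem one_add_mul (h : IsReducedProduct v M) {u : Fin 2 → R} {K} (hu : u ≠ 0)
    (hK : IsNilpotentLetter u K) :
    (1 + K) * M = 1 ∨ ∃ w, IsReducedProduct w ((1 + K) * M) := by
  by_cases hK0 : K = 0
  · subst hK0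
    exact Or.inr ⟨v, by simpa using h⟩
  by_cases huv : u 0 * v 1 = u 1 * v 0
  · have hK' := hK.congr hu huv
    cases h with
    | single hv hH hH0 =>
      rename_i H
      have : (1 + K) * (1 + H) = 1 + (K + H) := by
        rw [add_mul, mul_add, mul_add, hK'.mul_eq_zero hv hH]; simp; abel
      rw [this]
      by_cases h0 : K + H = 0
      · left; simp [h0]
      · exact Or.inr ⟨v, single hv (hK'.add hH) h0⟩
    | cons hv hH hH0 hvw hM =>
      rename_i w H M'
      have : (1 + K) * ((1 + H) * M') = (1 + (K + H)) * M' := by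
        rw [← mul_assoc]
        congr 1
        rw [add_mul, mul_add, mul_add, hK'.mul_eq_zero hv hH]; simp; abel
      rw [this]
      by_cases h0 : K + H = 0
      · exact Or.inr ⟨w, by simpa [h0] using hM⟩
      · exact Or.inr ⟨v, cons hv (hK'.add hH) h0 hvw hM⟩
  · exact Or.inr ⟨u, cons hu hK hK0 huv h⟩

/-- Over the fraction field the rows of `A` are multiples of v and the columns of `B` multiples of
(−w₁, w₀). The pairing of these two vectors is v₁w₀ − v₀w₁ ≠ 0. -/
theorem leadingCoeff_mul_ne_zero {v w : Fin 2 → R} {A B : Matrix (Fin 2) (Fin 2) R}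
    (hvw : v 0 * w 1 ≠ v 1 * w 0) (hA : A ≠ 0) (hB : B ≠ 0)
    (hAv : ∀ i, v 1 * A i 0 = v 0 * A i 1) (hBw : ∀ j, w 0 * B 0 j + w 1 * B 1 j = 0) :
    A * B ≠ 0 := by
  intro h
  obtain ⟨i, hi⟩ : ∃ i, A i ≠ 0 := by
    by_contra! hc
    exact hA (by ext i j; rw [hc i]; rfl)
  obtain ⟨j, hj⟩ : ∃ j, (B 0 j ≠ 0 ∨ B 1 j ≠ 0) := by
    by_contra! hc
    exact hB (by ext i j; fin_cases i <;> simp [hc j])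
  have h1 : A i 0 * B 0 j + A i 1 * B 1 j = 0 := by
    have := congrFun (congrFun h i) j
    rwa [Matrix.mul_apply, Fin.sum_univ_two] at this
  have h2 := hAv i
  have h3 := hBw j
  have h4 : v 0 * w 1 - v 1 * w 0 ≠ 0 := sub_ne_zero.2 hvw
  -- The row `A i` kills a nonzero column of `B`, so it is parallel to w as well as to v, hence
  -- zero.
  have h5 : A i 0 * w 1 - A i 1 * w 0 = 0 := by
    rcases hj with hj | hj
    · exact mul_left_cancel₀ hj (by linear_combination w 1 * h1 - A i 1 * h3)
    · exact mul_left_cancel₀ hj (by linear_combination -w 0 * h1 + A i 0 * h3)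
  refine hi (funext fun j => ?_)
  refine mul_left_cancel₀ h4 ?_
  rw [Pi.zero_apply, mul_zero]
  revert j
  rw [Fin.forall_fin_two]
  constructor
  · linear_combination v 0 * h5 - w 0 * h2
  · linear_combination v 1 * h5 - w 1 * h2

/-- Matrix coefficients have zero divisors, so additivity of degrees rests on the two leading
coefficients having nonzero product. -/
theorem natDegree_one_add_mul {v w : Fin 2 → R} {H M : (Matrix (Fin 2) (Fin 2) R)[X]}
    (hvw : v 0 * w 1 ≠ v 1 * w 0) (hH : IsNilpotentLetter v H)
    (hH0 : H ≠ 0) (hM0 : M ≠ 0)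
    (hM : ∀ j, w 0 * M.leadingCoeff 0 j + w 1 * M.leadingCoeff 1 j = 0) :
    ((1 + H) * M).natDegree = H.natDegree + M.natDegree ∧
      ((1 + H) * M).leadingCoeff = H.leadingCoeff * M.leadingCoeff ∧ (1 + H) * M ≠ 0 := by
  have h := leadingCoeff_mul_ne_zero hvw (leadingCoeff_ne_zero.2 hH0)
    (leadingCoeff_ne_zero.2 hM0) (hH.right _) hM
  rw [← hH.leadingCoeff_one_add hH0] at h
  rw [natDegree_mul' h, leadingCoeff_mul' h, hH.natDegree_one_add hH0,
    hH.leadingCoeff_one_add hH0]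
  refine ⟨rfl, rfl, fun h0 => h ?_⟩
  rw [← leadingCoeff_mul' h, h0, leadingCoeff_zero]

/-- The leading coefficient inherits the column condition of the first letter, which is what
multiplying by a further letter on the left requires. -/
theorem leadingCoeff_spec (h : IsReducedProduct v M) :
    0 < M.natDegree ∧ M ≠ 0 ∧
      ∀ j, v 0 * M.leadingCoeff 0 j + v 1 * M.leadingCoeff 1 j = 0 := by
  induction h with
  | single hv hH hH0 =>
    have h1 := hH.natDegree_one_add hH0
    have h2 := hH.natDegree_pos hH0
    refine ⟨by omega, fun h0 => ?_, fun j => ?_⟩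
    · rw [h0, natDegree_zero] at h1; omega
    · rw [hH.leadingCoeff_one_add hH0]; exact hH.left _ j
  | cons hv hH hH0 hvw hM ih =>
    rename_i v w H M
    obtain ⟨h1, h2, h3⟩ := natDegree_one_add_mul hvw hH hH0 ih.2.1 ih.2.2
    refine ⟨by omega, h3, fun j => ?_⟩
    rw [h2, Matrix.mul_apply, Matrix.mul_apply, Fin.sum_univ_two, Fin.sum_univ_two]
    have e0 : v 0 * H.leadingCoeff 0 0 + v 1 * H.leadingCoeff 1 0 = 0 := hH.left _ 0
    have e1 : v 0 * H.leadingCoeff 0 1 + v 1 * H.leadingCoeff 1 1 = 0 := hH.left _ 1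
    linear_combination M.leadingCoeff 0 j * e0 + M.leadingCoeff 1 j * e1

/-- A reduced product of degree two has at most two factors. -/
theorem of_natDegree_eq_two (h : IsReducedProduct v M) (hM : M.natDegree = 2) :
    IsNilpotentLetter v (M - 1) ∨ ∃ w H K, w ≠ 0 ∧ IsNilpotentLetter v H ∧
      IsNilpotentLetter w K ∧ H.natDegree = 1 ∧ K.natDegree = 1 ∧ M = (1 + H) * (1 + K) := by
  cases h with
  | single hv hH hH0 => left; simpa using hH
  | cons hv hH hH0 hvw hM' =>
    right
    rename_i w H M
    have hs := hM'.leadingCoeff_spec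
    have h1 := (natDegree_one_add_mul hvw hH hH0 hs.2.1 hs.2.2).1
    have h2 := hH.natDegree_pos hH0
    cases hM' with
    | single hw hK hK0 =>
      rename_i K
      have h3 := hK.natDegree_one_add hK0
      have h4 := hK.natDegree_pos hK0
      exact ⟨w, H, K, hw, hH, hK, by omega, by omega, rfl⟩
    | cons hw hK hK0 hwu hM'' =>
      have ht := hM''.leadingCoeff_spec
      have h3 := (natDegree_one_add_mul hwu hK hK0 ht.2.1 ht.2.2).1
      have h4 := hK.natDegree_pos hK0
      omega

/-- An analogue of Cohn's matrix is not a reduced product. -/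
theorem ne_cohn (h : IsReducedProduct v M) {a : R} (ha : a ≠ 0) (hu : ¬ IsUnit a)
    (hM : M.natDegree = 2) (h1 : M.coeff 1 = !![a, -a ^ 3; 0, -a])
    (h2 : M.coeff 2 = !![0, 0; -1, a ^ 2]) : False := by
  have hv := h.ne_zero
  rcases h.of_natDegree_eq_two hM with hH | ⟨w, H, K, hw, hH, hK, dH, dK, rfl⟩
  · have e : (M - 1).coeff 1 = !![a, -a ^ 3; 0, -a] := by
      rw [coeff_sub, h1, coeff_one]; simp
    -- A single letter would put v in the left kernel of the coefficient of s, whose determinant is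
    -- −a² ≠ 0.
    have e0 := hH.left 1 0
    have e1 := hH.left 1 1
    simp only [e, of_apply, cons_val_zero, cons_val_one, cons_val', cons_val_fin_one] at e0 e1
    have v0 : v 0 = 0 := mul_right_cancel₀ ha (by linear_combination e0)
    have v1 : v 1 = 0 := mul_right_cancel₀ ha (by linear_combination -e1 - a ^ 3 * v0)
    exact hv (by ext i; fin_cases i <;> assumption)
  · have hc1 : ((1 + H) * (1 + K)).coeff 1 = H.coeff 1 + K.coeff 1 := by
      rw [add_mul, mul_add, mul_add, one_mul, one_mul, mul_one, coeff_add, coeff_add, coeff_add,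
        coeff_mul]
      simp [Finset.Nat.antidiagonal_succ, hH.coeff_zero, hK.coeff_zero, coeff_one]
      abel
    have hc2 : ((1 + H) * (1 + K)).coeff 2 = H.coeff 1 * K.coeff 1 := by
      have hH2 : H.coeff 2 = 0 := coeff_eq_zero_of_natDegree_lt (by omega)
      have hK2 : K.coeff 2 = 0 := coeff_eq_zero_of_natDegree_lt (by omega)
      rw [add_mul, mul_add, mul_add, one_mul, one_mul, mul_one, coeff_add, coeff_add, coeff_add,
        coeff_mul]
      simp [Finset.Nat.antidiagonal_succ, hH.coeff_zero, hK.coeff_zero, coeff_one, hH2, hK2]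
    rw [hc1] at h1
    rw [hc2] at h2
    have s00 := congrFun (congrFun h1 0) 0
    have s10 := congrFun (congrFun h1 1) 0
    have s11 := congrFun (congrFun h1 1) 1
    have p00 := congrFun (congrFun h2 0) 0
    have p10 := congrFun (congrFun h2 1) 0
    have l0 := hH.left 1 0
    have l1 := hH.left 1 1
    have r1 := hH.right 1 1
    have r0 := hH.right 1 0
    simp [Matrix.mul_apply, Fin.sum_univ_two] at s00 s10 s11 p00 p10
    -- v is orthogonal to the columns of H₁K₁, the first of which is (0, −1).
    have v1 : v 1 = 0 := by
      linear_combination v 1 * p10 + v 0 * p00 - K.coeff 1 0 0 * l0 - K.coeff 1 1 0 * l1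
    have v0 : v 0 ≠ 0 := fun h0 => hv (by ext i; fin_cases i <;> assumption)
    -- As v = (v₀, 0), only the lower left entry h of H₁ survives. Then the upper left entry of K₁
    -- is a, and the lower left entry of H₁K₁ reads h a = −1.
    have a11 : H.coeff 1 1 1 = 0 :=
      mul_left_cancel₀ v0 (by linear_combination -r1 + H.coeff 1 1 0 * v1)
    have a00 : H.coeff 1 0 0 = 0 :=
      mul_left_cancel₀ v0 (by linear_combination l0 - H.coeff 1 1 0 * v1)
    refine hu (IsUnit.of_mul_eq_one (-H.coeff 1 1 0) ?_)
    linear_combination -p10 + H.coeff 1 1 0 * s00 - H.coeff 1 1 0 * a00 + K.coeff 1 1 0 * a11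

end IsReducedProduct

/-! ### Homomorphisms, and the polynomial part of an automorphism -/

namespace PoissonAlgebra.Hom

variable {k A B C : Type*} [CommRing k] [CommRing A] [Algebra k A] [PoissonAlgebra k A]
  [CommRing B] [Algebra k B] [PoissonAlgebra k B] [CommRing C] [Algebra k C] [PoissonAlgebra k C]

theorem map_bracket (f : Hom k A B) (a b : A) :
    f.toAlgHom (bracket (k := k) a b) = bracket (k := k) (f.toAlgHom a) (f.toAlgHom b) :=
  f.map_bracket' a b

/-- Composition of homomorphisms of Poisson algebras. -/
def comp (g : Hom k B C) (f : Hom k A B) : Hom k A C where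
  toAlgHom := g.toAlgHom.comp f.toAlgHom
  map_bracket' a b := by
    change g.toAlgHom (f.toAlgHom _) =
      bracket (g.toAlgHom (f.toAlgHom a)) (g.toAlgHom (f.toAlgHom b))
    rw [map_bracket, map_bracket]

theorem comp_apply (g : Hom k B C) (f : Hom k A B) (a : A) :
    (g.comp f).toAlgHom a = g.toAlgHom (f.toAlgHom a) := rfl

/-- The identity homomorphism. -/
def id (k A : Type*) [CommRing k] [CommRing A] [Algebra k A] [PoissonAlgebra k A] : Hom k A A where
  toAlgHom := AlgHom.id k A
  map_bracket' _ _ := rfl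

end PoissonAlgebra.Hom

namespace PoissonAlgebra

/-- An automorphism as a homomorphism. -/
def autHom {k A : Type*} [Field k] [CommRing A] [Algebra k A] [PoissonAlgebra k A]
    (φ : Aut k A) : Hom k A A where
  toAlgHom := φ.1
  map_bracket' := φ.2

theorem autHom_apply {k A : Type*} [Field k] [CommRing A] [Algebra k A] [PoissonAlgebra k A]
    (φ : Aut k A) (a : A) : (autHom φ).toAlgHom a = φ.1 a := rfl

theorem subset_adjoin {k A : Type*} [Field k] [CommRing A] [Algebra k A] [PoissonAlgebra k A]
    {s : Set A} {a : A} (ha : a ∈ s) : a ∈ adjoin k s :=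
  Algebra.mem_sInf.2 fun _ hS => hS.1 ha

theorem adjoin_le {k A : Type*} [Field k] [CommRing A] [Algebra k A] [PoissonAlgebra k A]
    {s : Set A} {S : Subalgebra k A} (hs : s ⊆ S)
    (hS : ∀ a ∈ S, ∀ b ∈ S, bracket (k := k) a b ∈ S) : adjoin k s ≤ S :=
  sInf_le ⟨hs, hS⟩

end PoissonAlgebra

namespace FreePoissonAlgebra

open PoissonAlgebra

variable {k X : Type*} [Field k]

/-- Mutually inverse endomorphisms of a free Poisson algebra form an automorphism. -/
def autOfInverse (f g : Hom k (FreePoissonAlgebra k X) (FreePoissonAlgebra k X))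
    (hfg : ∀ x, f.toAlgHom (g.toAlgHom (ι k x)) = ι k x)
    (hgf : ∀ x, g.toAlgHom (f.toAlgHom (ι k x)) = ι k x) : Aut k (FreePoissonAlgebra k X) :=
  ⟨AlgEquiv.ofAlgHom f.toAlgHom g.toAlgHom
    (AlgHom.ext fun a => hom_ext (f.comp g) (Hom.id _ _) hfg a)
    (AlgHom.ext fun a => hom_ext (g.comp f) (Hom.id _ _) hgf a), f.map_bracket'⟩

/-- The embedding of polynomials, as an associative algebra. -/
noncomputable def ofPoly (k X : Type*) [Field k] : MvPolynomial X k →ₐ[k] FreePoissonAlgebra k X :=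
  MvPolynomial.aeval (ι k)

theorem ofPoly_X (x : X) : ofPoly k X (MvPolynomial.X x) = ι k x := MvPolynomial.aeval_X _ _

theorem toPoly_ι (x : X) : (toPoly k X).toAlgHom (ι k x) = MvPolynomial.X x := lift_ι _ _

theorem toPoly_ofPoly (p : MvPolynomial X k) : (toPoly k X).toAlgHom (ofPoly k X p) = p := by
  have : (toPoly k X).toAlgHom.comp (ofPoly k X) = AlgHom.id k _ :=
    MvPolynomial.algHom_ext fun x => by simp [ofPoly_X, toPoly_ι]
  exact DFunLike.congr_fun this p

/-- Any algebra endomorphism of the polynomial algebra preserves the trivial bracket. -/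
def homOfAlgHom (f : MvPolynomial X k →ₐ[k] MvPolynomial X k) :
    Hom k (MvPolynomial X k) (MvPolynomial X k) where
  toAlgHom := f
  map_bracket' _ _ := map_zero f

theorem homOfAlgHom_apply (f : MvPolynomial X k →ₐ[k] MvPolynomial X k) (p : MvPolynomial X k) :
    (homOfAlgHom f).toAlgHom p = f p := rfl

/-- The endomorphism of the polynomial algebra induced by an endomorphism. -/
noncomputable def polyPart (φ : Hom k (FreePoissonAlgebra k X) (FreePoissonAlgebra k X)) :
    MvPolynomial X k →ₐ[k] MvPolynomial X k :=
  MvPolynomial.aeval fun x => (toPoly k X).toAlgHom (φ.toAlgHom (ι k x))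

theorem polyPart_X (φ : Hom k (FreePoissonAlgebra k X) (FreePoissonAlgebra k X)) (x : X) :
    polyPart φ (MvPolynomial.X x) = (toPoly k X).toAlgHom (φ.toAlgHom (ι k x)) := by
  rw [polyPart, MvPolynomial.aeval_X]

theorem toPoly_apply (φ : Hom k (FreePoissonAlgebra k X) (FreePoissonAlgebra k X))
    (a : FreePoissonAlgebra k X) :
    (toPoly k X).toAlgHom (φ.toAlgHom a) = polyPart φ ((toPoly k X).toAlgHom a) := by
  have h := hom_ext ((toPoly k X).comp φ) ((homOfAlgHom (polyPart φ)).comp (toPoly k X))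
    (fun x => by
      rw [Hom.comp_apply, Hom.comp_apply, toPoly_ι, homOfAlgHom_apply]
      exact (polyPart_X φ x).symm) a
  rwa [Hom.comp_apply, Hom.comp_apply, homOfAlgHom_apply] at h

theorem polyPart_eq (φ : Hom k (FreePoissonAlgebra k X) (FreePoissonAlgebra k X))
    (p : MvPolynomial X k) :
    polyPart φ p = (toPoly k X).toAlgHom (φ.toAlgHom (ofPoly k X p)) := by
  rw [toPoly_apply, toPoly_ofPoly]

/-- The action of the automorphism group on the polynomial algebra. -/
noncomputable def polyAut : Aut k (FreePoissonAlgebra k X) →*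
    (MvPolynomial X k ≃ₐ[k] MvPolynomial X k) where
  toFun φ := AlgEquiv.ofAlgHom (polyPart (autHom φ)) (polyPart (autHom φ⁻¹))
    (AlgHom.ext fun p => by
      rw [AlgHom.comp_apply, polyPart_eq (autHom φ⁻¹), ← toPoly_apply, autHom_apply,
        autHom_apply, ← AlgEquiv.mul_apply, ← Subgroup.coe_mul, mul_inv_cancel]
      exact toPoly_ofPoly p)
    (AlgHom.ext fun p => by
      rw [AlgHom.comp_apply, polyPart_eq (autHom φ), ← toPoly_apply, autHom_apply,
        autHom_apply, ← AlgEquiv.mul_apply, ← Subgroup.coe_mul, inv_mul_cancel]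
      exact toPoly_ofPoly p)
  map_one' := AlgEquiv.ext fun p => by
    change polyPart (autHom 1) p = p
    rw [polyPart_eq]
    exact toPoly_ofPoly p
  map_mul' φ ψ := AlgEquiv.ext fun p => by
    change polyPart (autHom (φ * ψ)) p = polyPart (autHom φ) (polyPart (autHom ψ) p)
    rw [polyPart_eq (autHom ψ), ← toPoly_apply, polyPart_eq]
    rfl

theorem toPoly_aut_apply (φ : Aut k (FreePoissonAlgebra k X)) (a : FreePoissonAlgebra k X) :
    (toPoly k X).toAlgHom (φ.1 a) = polyAut φ ((toPoly k X).toAlgHom a) :=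
  toPoly_apply (autHom φ) a

theorem polyAut_X (φ : Aut k (FreePoissonAlgebra k X)) (x : X) :
    polyAut φ (MvPolynomial.X x) = (toPoly k X).toAlgHom (φ.1 (ι k x)) := by
  rw [toPoly_aut_apply, toPoly_ι]

/-- The endomorphism with given polynomial values on the generators. -/
noncomputable def polyLift (β : MvPolynomial X k →ₐ[k] MvPolynomial X k) :
    Hom k (FreePoissonAlgebra k X) (FreePoissonAlgebra k X) :=
  lift fun x => ofPoly k X (β (MvPolynomial.X x))

theorem polyLift_ofPoly (β : MvPolynomial X k →ₐ[k] MvPolynomial X k) (p : MvPolynomial X k) :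
    (polyLift β).toAlgHom (ofPoly k X p) = ofPoly k X (β p) := by
  have : (polyLift β).toAlgHom.comp (ofPoly k X) = (ofPoly k X).comp β :=
    MvPolynomial.algHom_ext fun x => by
      rw [AlgHom.comp_apply, ofPoly_X]; exact lift_ι _ _
  exact DFunLike.congr_fun this p

/-- Automorphisms of the polynomial algebra lift to the free Poisson algebra. -/
noncomputable def polyAutLift : (MvPolynomial X k ≃ₐ[k] MvPolynomial X k) →*
    Aut k (FreePoissonAlgebra k X) where
  toFun β := autOfInverse (polyLift β.toAlgHom) (polyLift β.symm.toAlgHom)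
    (fun x => by rw [← ofPoly_X, polyLift_ofPoly, polyLift_ofPoly]; simp)
    (fun x => by rw [← ofPoly_X, polyLift_ofPoly, polyLift_ofPoly]; simp)
  map_one' := Subtype.ext (AlgEquiv.ext fun a =>
    hom_ext (polyLift _) (Hom.id _ _) (fun x => by
      rw [← ofPoly_X, polyLift_ofPoly]; rfl) a)
  map_mul' β γ := Subtype.ext (AlgEquiv.ext fun a =>
    hom_ext (polyLift _) ((polyLift _).comp (polyLift _)) (fun x => by
      rw [← ofPoly_X, polyLift_ofPoly, Hom.comp_apply, polyLift_ofPoly, polyLift_ofPoly]; rfl) a)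

theorem polyAutLift_ofPoly (β : MvPolynomial X k ≃ₐ[k] MvPolynomial X k) (p : MvPolynomial X k) :
    (polyAutLift β).1 (ofPoly k X p) = ofPoly k X (β p) :=
  polyLift_ofPoly _ p

theorem polyAutLift_ι (β : MvPolynomial X k ≃ₐ[k] MvPolynomial X k) (x : X) :
    (polyAutLift β).1 (ι k x) = ofPoly k X (β (MvPolynomial.X x)) := by
  rw [← ofPoly_X, polyAutLift_ofPoly]

theorem polyAut_polyAutLift (β : MvPolynomial X k ≃ₐ[k] MvPolynomial X k) :
    polyAut (polyAutLift β) = β :=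
  AlgEquiv.ext fun p => by
    rw [← toPoly_ofPoly p, ← toPoly_aut_apply, polyAutLift_ofPoly, toPoly_ofPoly, toPoly_ofPoly]

end FreePoissonAlgebra

/-! ### The jet algebra and the Jacobian matrix -/

namespace FreePoissonAlgebra

open PoissonAlgebra

section Jet

variable (k : Type*) [Field k]

/-- The square zero extension of `k[x₀, x₁, x₂]` by the square of `k[x₀, x₁, x₂][s]`. -/
abbrev Jet := TrivSqZeroExt (MvPolynomial (Fin 3) k) (Fin 2 → Polynomial (MvPolynomial (Fin 3) k))

variable {k}

theorem Jet.ext {a b : Jet k} (h : a.fst = b.fst) (h' : ∀ i, a.snd i = b.snd i) : a = b :=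
  TrivSqZeroExt.ext h (funext h')

theorem Jet.snd_mul_apply (a b : Jet k) (i : Fin 2) :
    (a * b).snd i = Polynomial.C a.fst * b.snd i + Polynomial.C b.fst * a.snd i := by
  rw [TrivSqZeroExt.snd_mul, op_smul_eq_smul, Pi.add_apply, Pi.smul_apply, Pi.smul_apply,
    Polynomial.smul_eq_C_mul, Polynomial.smul_eq_C_mul]

theorem Jet.algebraMap_eq (r : k) :
    algebraMap k (Polynomial (MvPolynomial (Fin 3) k)) r = Polynomial.C (algebraMap k _ r) := rfl

/-- One half of the bracket of the jet algebra. -/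
noncomputable def Jet.halfBracket (a b : Jet k) (i : Fin 2) : Polynomial (MvPolynomial (Fin 3) k) :=
  Polynomial.X * Polynomial.C (MvPolynomial.pderiv 2 a.fst) *
    (Polynomial.C (MvPolynomial.pderiv i.castSucc b.fst) + b.snd i)

/-- The bracket of the jet algebra: it is determined by `[x₂, xᵢ] = s eᵢ` for `i < 2`,
`[x₂, eⱼ] = s eⱼ` and `[x₀, x₁] = [xᵢ, eⱼ] = 0` for `i < 2`. -/
noncomputable def Jet.bracketAux (a b : Jet k) : Jet k :=
  TrivSqZeroExt.inr fun i => Jet.halfBracket a b i - Jet.halfBracket b a i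

noncomputable instance Jet.instPoisson : PoissonAlgebra k (Jet k) where
  bracket := LinearMap.mk₂ k Jet.bracketAux
    (fun a b c => Jet.ext (by simp [Jet.bracketAux]) fun i => by
      simp only [Jet.bracketAux, Jet.halfBracket, TrivSqZeroExt.snd_add, TrivSqZeroExt.snd_inr,
        TrivSqZeroExt.fst_add, map_add, Pi.add_apply]
      ring)
    (fun r a b => Jet.ext (by simp [Jet.bracketAux]) fun i => by
      simp only [Jet.bracketAux, Jet.halfBracket, TrivSqZeroExt.snd_smul, TrivSqZeroExt.snd_inr,
        TrivSqZeroExt.fst_smul, Derivation.map_smul, Pi.smul_apply]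
      simp only [Algebra.smul_def, map_mul, Jet.algebraMap_eq]
      ring)
    (fun a b c => Jet.ext (by simp [Jet.bracketAux]) fun i => by
      simp only [Jet.bracketAux, Jet.halfBracket, TrivSqZeroExt.snd_add, TrivSqZeroExt.snd_inr,
        TrivSqZeroExt.fst_add, map_add, Pi.add_apply]
      ring)
    (fun r a b => Jet.ext (by simp [Jet.bracketAux]) fun i => by
      simp only [Jet.bracketAux, Jet.halfBracket, TrivSqZeroExt.snd_smul, TrivSqZeroExt.snd_inr,
        TrivSqZeroExt.fst_smul, Derivation.map_smul, Pi.smul_apply]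
      simp only [Algebra.smul_def, map_mul, Jet.algebraMap_eq]
      ring)
  bracket_self a := Jet.ext (by simp [Jet.bracketAux]) fun i => by
    simp [Jet.bracketAux]
  jacobi a b c := Jet.ext (by simp [Jet.bracketAux]) fun i => by
    simp only [LinearMap.mk₂_apply, Jet.bracketAux, Jet.halfBracket, TrivSqZeroExt.snd_add,
      TrivSqZeroExt.snd_inr, TrivSqZeroExt.fst_inr, map_zero, Pi.add_apply, TrivSqZeroExt.snd_zero,
      Pi.zero_apply]
    ring
  leibniz a b c := Jet.ext (by simp [Jet.bracketAux]) fun i => by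
    simp only [LinearMap.mk₂_apply, Jet.bracketAux, Jet.halfBracket, TrivSqZeroExt.snd_add,
      Jet.snd_mul_apply, TrivSqZeroExt.fst_mul,
      TrivSqZeroExt.snd_inr, TrivSqZeroExt.fst_inr, map_zero, Pi.add_apply, Derivation.leibniz,
      smul_eq_mul, map_add, map_mul]
    ring

theorem Jet.fst_bracket (a b : Jet k) : (bracket (k := k) a b).fst = 0 := rfl

theorem Jet.snd_bracket (a b : Jet k) (i : Fin 2) :
    (bracket (k := k) a b).snd i =
      Polynomial.X * Polynomial.C (MvPolynomial.pderiv 2 a.fst) *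
        (Polynomial.C (MvPolynomial.pderiv i.castSucc b.fst) + b.snd i) -
      Polynomial.X * Polynomial.C (MvPolynomial.pderiv 2 b.fst) *
        (Polynomial.C (MvPolynomial.pderiv i.castSucc a.fst) + a.snd i) := rfl

/-- The second component of the endomorphism `xₗ ↦ xₗ + gₗ`. -/
noncomputable def Jet.shiftSnd (g : Fin 3 → Fin 2 → Polynomial (MvPolynomial (Fin 3) k)) (a : Jet k)
    (i : Fin 2) : Polynomial (MvPolynomial (Fin 3) k) :=
  Polynomial.C (MvPolynomial.pderiv 0 a.fst) * g 0 i +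
    Polynomial.C (MvPolynomial.pderiv 1 a.fst) * g 1 i +
    Polynomial.C (MvPolynomial.pderiv 2 a.fst) * g 2 i +
    (a.snd i + a.snd 0 * g 0 i + a.snd 1 * g 1 i)

/-- The endomorphism of the jet algebra with `xₗ ↦ xₗ + gₗ`. -/
noncomputable def Jet.shift (g : Fin 3 → Fin 2 → Polynomial (MvPolynomial (Fin 3) k)) :
    Hom k (Jet k) (Jet k) where
  toFun a := TrivSqZeroExt.inl a.fst + TrivSqZeroExt.inr (Jet.shiftSnd g a)
  map_one' := Jet.ext (by simp) fun i => by simp [Jet.shiftSnd]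
  map_zero' := Jet.ext (by simp) fun i => by simp [Jet.shiftSnd]
  map_mul' a b := Jet.ext (by simp) fun i => by
    simp only [Jet.shiftSnd, Jet.snd_mul_apply, TrivSqZeroExt.snd_add, TrivSqZeroExt.fst_add,
      TrivSqZeroExt.fst_mul, TrivSqZeroExt.snd_inl, TrivSqZeroExt.fst_inl, TrivSqZeroExt.snd_inr,
      TrivSqZeroExt.fst_inr, Derivation.leibniz, smul_eq_mul, map_add, map_mul, zero_add, add_zero]
    ring
  map_add' a b := Jet.ext (by simp) fun i => by
    simp only [Jet.shiftSnd, TrivSqZeroExt.snd_add, TrivSqZeroExt.fst_add, TrivSqZeroExt.snd_inl,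
      TrivSqZeroExt.snd_inr, map_add, zero_add, Pi.add_apply, Pi.zero_apply]
    ring
  commutes' r := Jet.ext (by simp) fun i => by
    simp [Jet.shiftSnd, TrivSqZeroExt.algebraMap_eq_inl', MvPolynomial.algebraMap_eq]
  -- On generators: [x₂ + g₂, xⱼ + gⱼ] = s (eⱼ + gⱼ) for j < 2, since g₂ brackets to zero with xⱼ
  -- and gⱼ. This forces eⱼ ↦ eⱼ + gⱼ.
  map_bracket' a b := Jet.ext (by simp [Jet.fst_bracket]) fun i => by
    simp only [Jet.shiftSnd, Jet.snd_bracket, Jet.fst_bracket, TrivSqZeroExt.snd_add,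
      TrivSqZeroExt.fst_add, TrivSqZeroExt.snd_inl, TrivSqZeroExt.fst_inl, TrivSqZeroExt.snd_inr,
      TrivSqZeroExt.fst_inr, map_zero, zero_add, add_zero, zero_mul, Fin.castSucc_zero,
      Fin.castSucc_one]
    ring

theorem Jet.fst_shift (g : Fin 3 → Fin 2 → Polynomial (MvPolynomial (Fin 3) k)) (a : Jet k) :
    ((Jet.shift g).toAlgHom a).fst = a.fst := by
  change (TrivSqZeroExt.inl a.fst + TrivSqZeroExt.inr (Jet.shiftSnd g a) : Jet k).fst = _
  simp

theorem Jet.snd_shift (g : Fin 3 → Fin 2 → Polynomial (MvPolynomial (Fin 3) k)) (a : Jet k)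
    (i : Fin 2) : ((Jet.shift g).toAlgHom a).snd i = Jet.shiftSnd g a i := by
  change (TrivSqZeroExt.inl a.fst + TrivSqZeroExt.inr (Jet.shiftSnd g a) : Jet k).snd i = _
  simp

/-- The projection of the jet algebra to the polynomial algebra. -/
noncomputable def Jet.fstHom : Hom k (Jet k) (MvPolynomial (Fin 3) k) where
  toAlgHom := TrivSqZeroExt.fstHom k _ _
  map_bracket' _ _ := rfl

theorem Jet.fstHom_apply (a : Jet k) : (Jet.fstHom (k := k)).toAlgHom a = a.fst := rfl

variable (k) in
/-- The homomorphism from the free Poisson algebra to the jet algebra. -/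
noncomputable def toJet : Hom k (FreePoissonAlgebra k (Fin 3)) (Jet k) :=
  lift fun x => TrivSqZeroExt.inl (MvPolynomial.X x)

theorem toJet_ι (x : Fin 3) :
    (toJet k).toAlgHom (ι k x) = TrivSqZeroExt.inl (MvPolynomial.X x) := lift_ι _ _

theorem fst_toJet (a : FreePoissonAlgebra k (Fin 3)) :
    ((toJet k).toAlgHom a).fst = (toPoly k (Fin 3)).toAlgHom a := by
  have h := hom_ext (Jet.fstHom.comp (toJet k)) (toPoly k (Fin 3)) (fun x => by
    rw [Hom.comp_apply, toJet_ι, toPoly_ι, Jet.fstHom_apply, TrivSqZeroExt.fst_inl]) a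
  rwa [Hom.comp_apply, Jet.fstHom_apply] at h

theorem toJet_ofPoly (p : MvPolynomial (Fin 3) k) :
    (toJet k).toAlgHom (ofPoly k (Fin 3) p) = TrivSqZeroExt.inl p := by
  have : (toJet k).toAlgHom.comp (ofPoly k (Fin 3)) = TrivSqZeroExt.inlAlgHom k _ _ :=
    MvPolynomial.algHom_ext fun x => by
      rw [AlgHom.comp_apply, ofPoly_X, toJet_ι, TrivSqZeroExt.inlAlgHom_apply]
  exact DFunLike.congr_fun this p

theorem toJet_apply {κ : Aut k (FreePoissonAlgebra k (Fin 3))} (hκ : polyAut κ = 1)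
    (a : FreePoissonAlgebra k (Fin 3)) :
    (toJet k).toAlgHom (κ.1 a) =
      (Jet.shift fun l => ((toJet k).toAlgHom (κ.1 (ι k l))).snd).toAlgHom
        ((toJet k).toAlgHom a) := by
  have h := hom_ext ((toJet k).comp (autHom κ))
    ((Jet.shift fun l => ((toJet k).toAlgHom (κ.1 (ι k l))).snd).comp (toJet k))
    (fun x => by
      rw [Hom.comp_apply, Hom.comp_apply, autHom_apply, toJet_ι]
      refine Jet.ext ?_ fun i => ?_
      · rw [fst_toJet, Jet.fst_shift, ← polyAut_X, hκ]; rfl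
      · rw [Jet.snd_shift]
        fin_cases x <;> simp [Jet.shiftSnd, MvPolynomial.pderiv_X]) a
  rwa [Hom.comp_apply, Hom.comp_apply, autHom_apply] at h

/-- The Jacobian matrix of an automorphism that is trivial modulo brackets. -/
noncomputable def jetMatrix (κ : Aut k (FreePoissonAlgebra k (Fin 3))) :
    Matrix (Fin 2) (Fin 2) (Polynomial (MvPolynomial (Fin 3) k)) :=
  1 + Matrix.of fun i j => ((toJet k).toAlgHom (κ.1 (ι k j.castSucc))).snd i

theorem jetMatrix_one : jetMatrix (1 : Aut k (FreePoissonAlgebra k (Fin 3))) = 1 := by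
  refine Matrix.ext fun i j => ?_
  rw [jetMatrix, Matrix.add_apply, Matrix.of_apply]
  change _ + ((toJet k).toAlgHom (ι k j.castSucc)).snd i = _
  rw [toJet_ι, TrivSqZeroExt.snd_inl, Pi.zero_apply, add_zero]

/-- The shift of κ acts on the ideal by its matrix, as eⱼ ↦ eⱼ + gⱼ. The displacement of x₂ plays no
role there, so 2 × 2 matrices suffice. -/
theorem jetMatrix_mul {κ ψ : Aut k (FreePoissonAlgebra k (Fin 3))} (hκ : polyAut κ = 1)
    (hψ : polyAut ψ = 1) : jetMatrix (κ * ψ) = jetMatrix κ * jetMatrix ψ := by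
  have h (j : Fin 3) : ((toJet k).toAlgHom (ψ.1 (ι k j))).fst = MvPolynomial.X j := by
    rw [fst_toJet, ← polyAut_X, hψ]; rfl
  refine Matrix.ext fun i j => ?_
  have h1 : (κ * ψ).1 (ι k j.castSucc) = κ.1 (ψ.1 (ι k j.castSucc)) := rfl
  rw [Matrix.mul_apply, Fin.sum_univ_two, jetMatrix, Matrix.add_apply, Matrix.of_apply, h1,
    toJet_apply hκ, Jet.snd_shift, Jet.shiftSnd, h]
  fin_cases i <;> fin_cases j <;>
    simp [jetMatrix, MvPolynomial.pderiv_X] <;> ring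

end Jet

end FreePoissonAlgebra

/-! ### Tame automorphisms give products of letters -/

namespace FreePoissonAlgebra

open PoissonAlgebra

variable {k : Type*} [Field k]

/-- The elements of the jet algebra annihilated by the vector field `v`, whose second component is
orthogonal to `v` and divisible by `s`. They form a Poisson subalgebra. -/
noncomputable def Jet.annihilated (v : Fin 3 → MvPolynomial (Fin 3) k) : Subalgebra k (Jet k) where
  carrier := {a |
    v 0 * MvPolynomial.pderiv 0 a.fst + v 1 * MvPolynomial.pderiv 1 a.fst +
      v 2 * MvPolynomial.pderiv 2 a.fst = 0 ∧
    Polynomial.C (v 0) * a.snd 0 + Polynomial.C (v 1) * a.snd 1 = 0 ∧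
    ∀ i, (a.snd i).coeff 0 = 0}
  mul_mem' := by
    rintro a b ⟨h1, h2, h3⟩ ⟨h1', h2', h3'⟩
    refine ⟨?_, ?_, fun i => ?_⟩
    · simp only [TrivSqZeroExt.fst_mul, Derivation.leibniz, smul_eq_mul]
      linear_combination b.fst * h1 + a.fst * h1'
    · simp only [Jet.snd_mul_apply]
      linear_combination Polynomial.C b.fst * h2 + Polynomial.C a.fst * h2'
    · simp [Jet.snd_mul_apply, h3, h3']
  add_mem' := by
    rintro a b ⟨h1, h2, h3⟩ ⟨h1', h2', h3'⟩
    refine ⟨?_, ?_, fun i => ?_⟩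
    · simp only [TrivSqZeroExt.fst_add, map_add]
      linear_combination h1 + h1'
    · simp only [TrivSqZeroExt.snd_add, Pi.add_apply]
      linear_combination h2 + h2'
    · simp [h3, h3']
  algebraMap_mem' r := by
    simp [TrivSqZeroExt.algebraMap_eq_inl', MvPolynomial.algebraMap_eq]

/-- For annihilated b, v₀(∂₀b + b₀) + v₁(∂₁b + b₁) = −v₂∂₂b. Pairing v with the bracket thus leaves
−s v₂(∂₂a ∂₂b − ∂₂b ∂₂a) = 0. -/
theorem Jet.bracket_mem_annihilated {v : Fin 3 → MvPolynomial (Fin 3) k} {a b : Jet k}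
    (ha : a ∈ Jet.annihilated v) (hb : b ∈ Jet.annihilated v) :
    bracket (k := k) a b ∈ Jet.annihilated v := by
  obtain ⟨h1, h2, -⟩ := ha
  obtain ⟨h1', h2', -⟩ := hb
  refine ⟨?_, ?_, fun i => ?_⟩
  · simp [Jet.fst_bracket]
  · have e := congrArg (Polynomial.C (R := MvPolynomial (Fin 3) k)) h1
    have e' := congrArg (Polynomial.C (R := MvPolynomial (Fin 3) k)) h1'
    simp only [map_add, map_mul, map_zero] at e e'
    simp only [Jet.snd_bracket, Fin.castSucc_zero, Fin.castSucc_one]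
    linear_combination
      Polynomial.X * Polynomial.C (MvPolynomial.pderiv 2 a.fst) * (e' + h2') -
        Polynomial.X * Polynomial.C (MvPolynomial.pderiv 2 b.fst) * (e + h2)
  · simp [Jet.snd_bracket, Polynomial.mul_coeff_zero]

/-- δ∂ᵢδ⁻¹ is a derivation, so its values on the variables determine it; these become the vector
field v of `Jet.annihilated`. -/
theorem conj_pderiv (δ : MvPolynomial (Fin 3) k ≃ₐ[k] MvPolynomial (Fin 3) k) (i : Fin 3)
    (c : MvPolynomial (Fin 3) k) :
    δ (MvPolynomial.pderiv i (δ.symm c)) =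
      δ (MvPolynomial.pderiv i (δ.symm (MvPolynomial.X 0))) * MvPolynomial.pderiv 0 c +
      δ (MvPolynomial.pderiv i (δ.symm (MvPolynomial.X 1))) * MvPolynomial.pderiv 1 c +
      δ (MvPolynomial.pderiv i (δ.symm (MvPolynomial.X 2))) * MvPolynomial.pderiv 2 c := by
  induction c using MvPolynomial.induction_on with
  | C a =>
    rw [← MvPolynomial.algebraMap_eq, AlgEquiv.commutes]
    simp
  | add p q hp hq => simp only [map_add, hp, hq]; ring
  | mul_X p n hp =>
    simp only [map_mul, map_add, Derivation.leibniz, smul_eq_mul, AlgEquiv.apply_symm_apply, hp]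
    fin_cases n <;> simp [MvPolynomial.pderiv_X] <;> ring

theorem fst_toJet_ofPoly {κ : Aut k (FreePoissonAlgebra k (Fin 3))} (hκ : polyAut κ = 1)
    (c : MvPolynomial (Fin 3) k) : ((toJet k).toAlgHom (κ.1 (ofPoly k (Fin 3) c))).fst = c := by
  rw [fst_toJet, toPoly_aut_apply, hκ, toPoly_ofPoly]; rfl

/-- Chain rule: among the coordinates δ(xⱼ) only the i-th is displaced by κ, so only ∂ᵢ contributes.
-/
theorem snd_toJet_ofPoly {κ : Aut k (FreePoissonAlgebra k (Fin 3))} (hκ : polyAut κ = 1)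
    (δ : MvPolynomial (Fin 3) k ≃ₐ[k] MvPolynomial (Fin 3) k) {i : Fin 3}
    {F : Fin 2 → Polynomial (MvPolynomial (Fin 3) k)}
    (hi : ((toJet k).toAlgHom (κ.1 (ofPoly k (Fin 3) (δ (MvPolynomial.X i))))).snd = F)
    (hj : ∀ j, j ≠ i →
      ((toJet k).toAlgHom (κ.1 (ofPoly k (Fin 3) (δ (MvPolynomial.X j))))).snd = 0)
    (p : MvPolynomial (Fin 3) k) (m : Fin 2) :
    ((toJet k).toAlgHom (κ.1 (ofPoly k (Fin 3) (δ p)))).snd m =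
      Polynomial.C (δ (MvPolynomial.pderiv i p)) * F m := by
  induction p using MvPolynomial.induction_on with
  | C a =>
    rw [← MvPolynomial.algebraMap_eq, AlgEquiv.commutes, AlgHom.commutes, AlgEquiv.commutes,
      AlgHom.commutes]
    simp [TrivSqZeroExt.algebraMap_eq_inl']
  | add p q hp hq =>
    simp only [map_add, TrivSqZeroExt.snd_add, Pi.add_apply, hp, hq, add_mul]
  | mul_X p n hp =>
    have hn : ((toJet k).toAlgHom (κ.1 (ofPoly k (Fin 3) (δ (MvPolynomial.X n))))).snd m =
        Polynomial.C (δ (MvPolynomial.pderiv i (MvPolynomial.X n))) * F m := by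
      by_cases h : n = i
      · subst h; simp [hi]
      · rw [hj n h, MvPolynomial.pderiv_X_of_ne h]; simp
    simp only [map_mul, Jet.snd_mul_apply, fst_toJet_ofPoly hκ, hp, hn, Derivation.leibniz,
      smul_eq_mul, map_add]
    ring

/-- The monoid of products of factors `1 + H` with nilpotent letters `H`. -/
noncomputable def letterMonoid (R : Type*) [CommRing R] :
    Submonoid (Polynomial (Matrix (Fin 2) (Fin 2) R)) :=
  Submonoid.closure {M | ∃ v H, v ≠ 0 ∧ IsNilpotentLetter v H ∧ M = 1 + H}

theorem exists_isReducedProduct {R : Type*} [CommRing R] [IsDomain R]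
    {M : Polynomial (Matrix (Fin 2) (Fin 2) R)} (hM : M ∈ letterMonoid R) :
    M = 1 ∨ ∃ v, IsReducedProduct v M := by
  induction hM using Submonoid.closure_induction_left with
  | one => exact Or.inl rfl
  | mul_left x hx y hy ih =>
    obtain ⟨v, H, hv, hH, rfl⟩ := hx
    rcases ih with rfl | ⟨w, hw⟩
    · by_cases h0 : H = 0
      · left; simp [h0]
      · exact Or.inr ⟨v, by simpa using IsReducedProduct.single hv hH h0⟩
    · exact hw.one_add_mul hv hH

theorem exists_inv_mem_letterMonoid {R : Type*} [CommRing R] [IsDomain R]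
    {M : Polynomial (Matrix (Fin 2) (Fin 2) R)} (hM : M ∈ letterMonoid R) :
    ∃ M' ∈ letterMonoid R, M * M' = 1 := by
  induction hM using Submonoid.closure_induction with
  | mem x hx =>
    obtain ⟨v, H, hv, hH, rfl⟩ := hx
    refine ⟨1 + -H, Submonoid.subset_closure ⟨v, -H, hv, hH.neg, rfl⟩, ?_⟩
    rw [add_mul, mul_add, mul_add, hH.mul_eq_zero hv hH.neg]; simp
  | one => exact ⟨1, one_mem _, one_mul 1⟩
  | mul x y _ _ hx hy =>
    obtain ⟨x', hx', h1⟩ := hx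
    obtain ⟨y', hy', h2⟩ := hy
    refine ⟨y' * x', mul_mem hy' hx', ?_⟩
    rw [mul_assoc, ← mul_assoc y, h2, one_mul, h1]

/-- The part of `φ` that is trivial modulo brackets, conjugated by `γ`. -/
noncomputable def bracketPart (γ : MvPolynomial (Fin 3) k ≃ₐ[k] MvPolynomial (Fin 3) k)
    (φ : Aut k (FreePoissonAlgebra k (Fin 3))) : Aut k (FreePoissonAlgebra k (Fin 3)) :=
  polyAutLift γ * φ * (polyAutLift (γ * polyAut φ))⁻¹

theorem polyAut_bracketPart (γ : MvPolynomial (Fin 3) k ≃ₐ[k] MvPolynomial (Fin 3) k)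
    (φ : Aut k (FreePoissonAlgebra k (Fin 3))) : polyAut (bracketPart γ φ) = 1 := by
  rw [bracketPart, map_mul, map_mul, map_inv, polyAut_polyAutLift, polyAut_polyAutLift,
    mul_inv_cancel]

/-- This cocycle identity is the reason for the parameter γ: the second factor is seen after a
change of polynomial coordinates. -/
theorem bracketPart_mul (γ : MvPolynomial (Fin 3) k ≃ₐ[k] MvPolynomial (Fin 3) k)
    (φ ψ : Aut k (FreePoissonAlgebra k (Fin 3))) :
    bracketPart γ (φ * ψ) = bracketPart γ φ * bracketPart (γ * polyAut φ) ψ := by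
  simp only [bracketPart, map_mul]
  group

theorem bracketPart_one (γ : MvPolynomial (Fin 3) k ≃ₐ[k] MvPolynomial (Fin 3) k) :
    bracketPart γ (1 : Aut k (FreePoissonAlgebra k (Fin 3))) = 1 := by
  rw [bracketPart, map_one, mul_one, mul_one, mul_inv_cancel]

/-- Let v be the field δ∂ᵢδ⁻¹. The generators xⱼ, j ≠ i, go to polynomials killed by v, so f goes
into the subalgebra annihilated by v. Its second component F is then orthogonal to v and divisible
by s, and the matrix is 1 + F (v₀, v₁). -/
theorem matPolyEquiv_jetMatrix_mem_of_isElementary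
    (γ : MvPolynomial (Fin 3) k ≃ₐ[k] MvPolynomial (Fin 3) k)
    {φ : Aut k (FreePoissonAlgebra k (Fin 3))} (hφ : IsElementary k (ι k) φ) :
    matPolyEquiv (jetMatrix (bracketPart γ φ)) ∈ letterMonoid (MvPolynomial (Fin 3) k) := by
  obtain ⟨i, α, f, -, hf, hi, hj⟩ := hφ
  set δ := γ * polyAut φ with hδ
  have hδj (j : Fin 3) (h : j ≠ i) : δ (MvPolynomial.X j) = γ (MvPolynomial.X j) := by
    rw [hδ, AlgEquiv.mul_apply, polyAut_X, hj j h, toPoly_ι]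
  have hκ := polyAut_bracketPart γ φ
  have hκδ (l : Fin 3) : (bracketPart γ φ).1 (ofPoly k (Fin 3) (δ (MvPolynomial.X l))) =
      (polyAutLift γ).1 (φ.1 (ι k l)) := by
    rw [← polyAutLift_ι δ l, ← AlgEquiv.mul_apply, ← Subgroup.coe_mul, bracketPart,
      inv_mul_cancel_right]
    rfl
  set v : Fin 3 → MvPolynomial (Fin 3) k :=
    fun l => δ (MvPolynomial.pderiv i (δ.symm (MvPolynomial.X l))) with hv
  have hmem : (toJet k).toAlgHom ((polyAutLift γ).1 f) ∈ Jet.annihilated v := by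
    have hle : adjoin k (ι k '' {j | j ≠ i}) ≤ (Jet.annihilated v).comap
        ((toJet k).comp (autHom (polyAutLift γ))).toAlgHom := by
      refine adjoin_le ?_ fun a ha b hb => ?_
      · rintro _ ⟨j, hji, rfl⟩
        change (toJet k).toAlgHom ((polyAutLift γ).1 (ι k j)) ∈ Jet.annihilated v
        rw [polyAutLift_ι, toJet_ofPoly, ← hδj j hji]
        refine ⟨?_, by simp, by simp⟩
        rw [TrivSqZeroExt.fst_inl, ← conj_pderiv, AlgEquiv.symm_apply_apply,
          MvPolynomial.pderiv_X_of_ne hji, map_zero]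
      · rw [Subalgebra.mem_comap] at ha hb ⊢
        rw [Hom.map_bracket]
        exact Jet.bracket_mem_annihilated ha hb
    exact hle hf
  set F := ((toJet k).toAlgHom ((polyAutLift γ).1 f)).snd with hF
  -- The chain rule applied to δ⁻¹(xₗ).
  have hg (l : Fin 3) (m : Fin 2) :
      ((toJet k).toAlgHom ((bracketPart γ φ).1 (ι k l))).snd m = Polynomial.C (v l) * F m := by
    have := snd_toJet_ofPoly hκ δ (i := i) (F := F)
      (by
        rw [hκδ, hi, map_add, map_add, map_smul, map_smul, polyAutLift_ι, toJet_ofPoly]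
        simp [hF])
      (fun j h => by rw [hκδ, hj j h, polyAutLift_ι, toJet_ofPoly, TrivSqZeroExt.snd_inl])
      (δ.symm (MvPolynomial.X l)) m
    rwa [AlgEquiv.apply_symm_apply, ofPoly_X] at this
  have hc (n : ℕ) (a b : Fin 2) : (matPolyEquiv (jetMatrix (bracketPart γ φ)) - 1).coeff n a b =
      v b.castSucc * (F a).coeff n := by
    rw [← map_one matPolyEquiv, ← map_sub, matPolyEquiv_coeff_apply, jetMatrix, add_sub_cancel_left,
      Matrix.of_apply, hg, Polynomial.coeff_C_mul]
  obtain ⟨-, h2, h3⟩ := hmem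
  have h2' (n : ℕ) : v 0 * (F 0).coeff n + v 1 * (F 1).coeff n = 0 := by
    have := congrArg (fun p => Polynomial.coeff p n) h2
    simpa using this
  -- A letter needs a nonzero direction; without one the matrix is 1.
  by_cases hv0 : v 0 = 0 ∧ v 1 = 0
  · have : matPolyEquiv (jetMatrix (bracketPart γ φ)) - 1 = 0 := by
      refine Polynomial.ext fun n => ?_
      ext a b : 1
      rw [hc]
      fin_cases b <;> simp [hv0]
    rw [sub_eq_zero.1 this]
    exact one_mem _
  · refine Submonoid.subset_closure ⟨![v 0, v 1], _, fun h => hv0 ?_, ⟨?_, fun n j => ?_,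
      fun n i => ?_⟩, (add_sub_cancel _ _).symm⟩
    · exact ⟨congrFun h 0, congrFun h 1⟩
    · ext a b : 1
      rw [hc, h3, mul_zero, Matrix.zero_apply]
    · rw [hc, hc]
      simp only [Matrix.cons_val_zero, Matrix.cons_val_one]
      linear_combination v j.castSucc * h2' n
    · rw [hc, hc]
      simp only [Matrix.cons_val_zero, Matrix.cons_val_one, Fin.castSucc_zero, Fin.castSucc_one]
      ring

/-- The Jacobian matrix of the bracket part of a tame automorphism is a product of letters. -/
theorem matPolyEquiv_jetMatrix_mem_of_mem_tameAut {φ : Aut k (FreePoissonAlgebra k (Fin 3))}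
    (hφ : φ ∈ tameAut k (ι k)) (γ : MvPolynomial (Fin 3) k ≃ₐ[k] MvPolynomial (Fin 3) k) :
    matPolyEquiv (jetMatrix (bracketPart γ φ)) ∈ letterMonoid (MvPolynomial (Fin 3) k) := by
  induction hφ using Subgroup.closure_induction generalizing γ with
  | mem φ hφ => exact matPolyEquiv_jetMatrix_mem_of_isElementary γ hφ
  | one => rw [bracketPart_one, jetMatrix_one, map_one]; exact one_mem _
  | mul φ ψ _ _ hφ hψ =>
    rw [bracketPart_mul, jetMatrix_mul (polyAut_bracketPart _ _) (polyAut_bracketPart _ _), map_mul]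
    exact mul_mem (hφ _) (hψ _)
  | inv φ _ hφ =>
    -- The cocycle identity for φ⁻¹φ = 1 makes the matrix of φ⁻¹ a left inverse of a product of
    -- letters, and such a product has an inverse of the same kind.
    have h := bracketPart_mul γ φ⁻¹ φ
    rw [inv_mul_cancel, bracketPart_one] at h
    have h' := jetMatrix_mul (polyAut_bracketPart γ φ⁻¹)
      (polyAut_bracketPart (γ * polyAut φ⁻¹) φ)
    rw [← h, jetMatrix_one] at h'
    obtain ⟨M, hM, hM'⟩ := exists_inv_mem_letterMonoid (hφ (γ * polyAut φ⁻¹))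
    have h1 := congrArg matPolyEquiv h'
    rw [map_one, map_mul] at h1
    rwa [left_inv_eq_right_inv h1.symm hM']

end FreePoissonAlgebra

/-! ### The Anick type automorphism and its matrix -/

namespace FreePoissonAlgebra

open PoissonAlgebra

section Anick

variable (k : Type*) [Field k]

/-- The inverse of the Anick type endomorphism. -/
def anickInv : Hom k (FreePoissonAlgebra k (Fin 3)) (FreePoissonAlgebra k (Fin 3)) :=
  lift ![ι k 0 - bracket (k := k) (ι k 2) (anickElt k), ι k 1 - anickElt k * ι k 2, ι k 2]

theorem anick_ι_zero : (anick k).toAlgHom (ι k 0) =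
    ι k 0 + bracket (k := k) (ι k 2) (anickElt k) := lift_ι _ _

theorem anick_ι_one : (anick k).toAlgHom (ι k 1) = ι k 1 + anickElt k * ι k 2 := lift_ι _ _

theorem anick_ι_two : (anick k).toAlgHom (ι k 2) = ι k 2 := lift_ι _ _

theorem anickInv_ι_zero : (anickInv k).toAlgHom (ι k 0) =
    ι k 0 - bracket (k := k) (ι k 2) (anickElt k) := lift_ι _ _

theorem anickInv_ι_one : (anickInv k).toAlgHom (ι k 1) = ι k 1 - anickElt k * ι k 2 := lift_ι _ _

theorem anickInv_ι_two : (anickInv k).toAlgHom (ι k 2) = ι k 2 := lift_ι _ _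

/-- The added terms [x₂, w] x₂ and [x₂, w x₂] = x₂ [x₂, w] cancel. -/
theorem anick_anickElt : (anick k).toAlgHom (anickElt k) = anickElt k := by
  conv_lhs => rw [anickElt]
  rw [map_sub, map_mul, Hom.map_bracket, anick_ι_zero, anick_ι_one, anick_ι_two, map_add, leibniz,
    bracket_self]
  conv_rhs => rw [anickElt]
  ring

theorem anickInv_anickElt : (anickInv k).toAlgHom (anickElt k) = anickElt k := by
  conv_lhs => rw [anickElt]
  rw [map_sub, map_mul, Hom.map_bracket, anickInv_ι_zero, anickInv_ι_one, anickInv_ι_two, map_sub,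
    leibniz, bracket_self]
  conv_rhs => rw [anickElt]
  ring

/-- The Anick type automorphism. -/
def anickAut : Aut k (FreePoissonAlgebra k (Fin 3)) :=
  autOfInverse (anick k) (anickInv k)
    (fun x => by
      fin_cases x
      · change (anick k).toAlgHom ((anickInv k).toAlgHom (ι k 0)) = ι k 0
        rw [anickInv_ι_zero, map_sub, Hom.map_bracket, anick_anickElt, anick_ι_zero, anick_ι_two,
          add_sub_cancel_right]
      · change (anick k).toAlgHom ((anickInv k).toAlgHom (ι k 1)) = ι k 1
        rw [anickInv_ι_one, map_sub, map_mul, anick_anickElt, anick_ι_one, anick_ι_two,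
          add_sub_cancel_right]
      · change (anick k).toAlgHom ((anickInv k).toAlgHom (ι k 2)) = ι k 2
        rw [anickInv_ι_two, anick_ι_two])
    (fun x => by
      fin_cases x
      · change (anickInv k).toAlgHom ((anick k).toAlgHom (ι k 0)) = ι k 0
        rw [anick_ι_zero, map_add, Hom.map_bracket, anickInv_anickElt, anickInv_ι_zero,
          anickInv_ι_two, sub_add_cancel]
      · change (anickInv k).toAlgHom ((anick k).toAlgHom (ι k 1)) = ι k 1
        rw [anick_ι_one, map_add, map_mul, anickInv_anickElt, anickInv_ι_one, anickInv_ι_two,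
          sub_add_cancel]
      · change (anickInv k).toAlgHom ((anick k).toAlgHom (ι k 2)) = ι k 2
        rw [anick_ι_two, anickInv_ι_two])

theorem anickAut_apply (a : FreePoissonAlgebra k (Fin 3)) :
    (anickAut k).1 a = (anick k).toAlgHom a := rfl

theorem toPoly_bracket (a b : FreePoissonAlgebra k (Fin 3)) :
    (toPoly k (Fin 3)).toAlgHom (bracket (k := k) a b) = 0 :=
  Hom.map_bracket _ a b

theorem polyAut_anickAut_X_zero :
    polyAut (anickAut k) (MvPolynomial.X 0) = MvPolynomial.X 0 := by
  rw [polyAut_X, anickAut_apply, anick_ι_zero, map_add, toPoly_bracket, toPoly_ι, add_zero]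

theorem polyAut_anickAut_X_one :
    polyAut (anickAut k) (MvPolynomial.X 1) =
      MvPolynomial.X 1 + MvPolynomial.X 0 * MvPolynomial.X 2 ^ 2 := by
  rw [polyAut_X, anickAut_apply, anick_ι_one, map_add, map_mul, anickElt, map_sub, map_mul,
    toPoly_bracket, toPoly_ι, toPoly_ι, toPoly_ι]
  ring

theorem polyAut_anickAut_X_two :
    polyAut (anickAut k) (MvPolynomial.X 2) = MvPolynomial.X 2 := by
  rw [polyAut_X, anickAut_apply, anick_ι_two, toPoly_ι]

/-- The automorphism of the polynomial algebra induced by the Anick type automorphism. -/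
noncomputable def anickPolyAut : Aut k (MvPolynomial (Fin 3) k) :=
  ⟨polyAut (anickAut k), fun _ _ => map_zero _⟩

theorem anickPolyAut_mem_tameAut :
    anickPolyAut k ∈ tameAut k (MvPolynomial.X : Fin 3 → MvPolynomial (Fin 3) k) := by
  refine Subgroup.subset_closure ⟨1, 1, MvPolynomial.X 0 * MvPolynomial.X 2 ^ 2, one_ne_zero, ?_,
    ?_, fun j hj => ?_⟩
  · have h (j : Fin 3) (hj : j ≠ 1) : (MvPolynomial.X j : MvPolynomial (Fin 3) k) ∈
        adjoin k (MvPolynomial.X '' {j | j ≠ 1}) := subset_adjoin ⟨j, hj, rfl⟩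
    exact mul_mem (h 0 (by decide)) (pow_mem (h 2 (by decide)) 2)
  · rw [one_smul]; exact polyAut_anickAut_X_one k
  · fin_cases j
    · exact polyAut_anickAut_X_zero k
    · exact absurd rfl hj
    · exact polyAut_anickAut_X_two k

theorem polyAut_anickAut_symm_X_zero :
    (polyAut (anickAut k)).symm (MvPolynomial.X 0) = MvPolynomial.X 0 := by
  rw [AlgEquiv.symm_apply_eq, polyAut_anickAut_X_zero]

theorem polyAut_anickAut_symm_X_one :
    (polyAut (anickAut k)).symm (MvPolynomial.X 1) =
      MvPolynomial.X 1 - MvPolynomial.X 0 * MvPolynomial.X 2 ^ 2 := by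
  rw [AlgEquiv.symm_apply_eq, map_sub, map_mul, map_pow, polyAut_anickAut_X_zero,
    polyAut_anickAut_X_one, polyAut_anickAut_X_two, add_sub_cancel_right]

theorem bracketPart_anickAut_ofPoly (p : MvPolynomial (Fin 3) k) :
    (bracketPart 1 (anickAut k)).1 (ofPoly k (Fin 3) p) =
      (anick k).toAlgHom (ofPoly k (Fin 3) ((polyAut (anickAut k)).symm p)) := by
  have h : bracketPart 1 (anickAut k) = anickAut k * polyAutLift (polyAut (anickAut k))⁻¹ := by
    rw [bracketPart, map_one, one_mul, one_mul, map_inv]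
  rw [h, Subgroup.coe_mul, AlgEquiv.mul_apply, polyAutLift_ofPoly]
  rfl

/-- The last variable as a constant polynomial in `s`. -/
noncomputable abbrev jetVar : Polynomial (MvPolynomial (Fin 3) k) :=
  Polynomial.C (MvPolynomial.X 2)

/-- The jet of w is x₀x₂ − s e₁, and its bracket with x₂ is s x₂ e₀ − s² e₁. -/
theorem snd_toJet_bracketPart_anickAut_zero (i : Fin 2) :
    ((toJet k).toAlgHom ((bracketPart 1 (anickAut k)).1 (ι k 0))).snd i =
      (![jetVar k * Polynomial.X, -Polynomial.X ^ 2] :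
        Fin 2 → Polynomial (MvPolynomial (Fin 3) k)) i := by
  rw [← ofPoly_X, bracketPart_anickAut_ofPoly, polyAut_anickAut_symm_X_zero, ofPoly_X,
    anick_ι_zero, anickElt]
  simp only [map_add, map_sub, map_mul, Hom.map_bracket, toJet_ι]
  simp only [TrivSqZeroExt.snd_add, TrivSqZeroExt.snd_sub, Pi.add_apply, Pi.sub_apply,
    Jet.snd_mul_apply, Jet.snd_bracket, Jet.fst_bracket, TrivSqZeroExt.fst_mul,
    TrivSqZeroExt.fst_inl, TrivSqZeroExt.snd_inl,
    Derivation.leibniz, Pi.zero_apply, map_zero, map_add]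
  fin_cases i <;> simp [MvPolynomial.pderiv_X]
  ring

/-- Here x₁ goes to x₁ + w x₂ − (x₀ + [x₂, w]) x₂². -/
theorem snd_toJet_bracketPart_anickAut_one (i : Fin 2) :
    ((toJet k).toAlgHom ((bracketPart 1 (anickAut k)).1 (ι k 1))).snd i =
      (![-jetVar k ^ 3 * Polynomial.X,
        -jetVar k * Polynomial.X +
          jetVar k ^ 2 * Polynomial.X ^ 2] :
        Fin 2 → Polynomial (MvPolynomial (Fin 3) k)) i := by
  rw [← ofPoly_X, bracketPart_anickAut_ofPoly, polyAut_anickAut_symm_X_one]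
  simp only [map_sub, map_mul, map_pow, ofPoly_X, anick_ι_zero, anick_ι_one, anick_ι_two, anickElt]
  simp only [map_add, map_sub, map_mul, Hom.map_bracket, toJet_ι, pow_two]
  simp only [TrivSqZeroExt.snd_add, TrivSqZeroExt.snd_sub, Pi.add_apply, Pi.sub_apply,
    Jet.snd_mul_apply, Jet.snd_bracket, Jet.fst_bracket, TrivSqZeroExt.fst_mul,
    TrivSqZeroExt.fst_add, TrivSqZeroExt.fst_sub, TrivSqZeroExt.fst_inl, TrivSqZeroExt.snd_inl,
    Derivation.leibniz, Pi.zero_apply, map_zero, map_sub, map_add]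
  fin_cases i <;> simp [MvPolynomial.pderiv_X] <;> ring

theorem jetMatrix_anickAut : jetMatrix (bracketPart 1 (anickAut k)) =
    (!![1 + jetVar k * Polynomial.X, -(Polynomial.C (MvPolynomial.X 2 ^ 3) * Polynomial.X);
      -Polynomial.X ^ 2,
      1 - jetVar k * Polynomial.X + Polynomial.C (MvPolynomial.X 2 ^ 2) * Polynomial.X ^ 2] :
      Matrix (Fin 2) (Fin 2) (Polynomial (MvPolynomial (Fin 3) k))) := by
  refine Matrix.ext fun i j => ?_
  rw [jetMatrix, Matrix.add_apply, Matrix.of_apply]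
  fin_cases j
  · change _ + ((toJet k).toAlgHom ((bracketPart 1 (anickAut k)).1 (ι k 0))).snd i = _
    rw [snd_toJet_bracketPart_anickAut_zero]
    fin_cases i <;> simp
  · change _ + ((toJet k).toAlgHom ((bracketPart 1 (anickAut k)).1 (ι k 1))).snd i = _
    rw [snd_toJet_bracketPart_anickAut_one]
    fin_cases i <;> simp [jetVar] <;> ring

theorem isWild_anickAut : IsWild k (ι k) (anickAut k) := by
  intro h
  have hmem := matPolyEquiv_jetMatrix_mem_of_mem_tameAut h 1
  have hc (n : ℕ) (i j : Fin 2) := matPolyEquiv_coeff_apply (jetMatrix (bracketPart 1 (anickAut k)))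
    n i j
  rw [jetMatrix_anickAut, jetVar] at hmem hc
  set a : MvPolynomial (Fin 3) k := MvPolynomial.X 2
  have h1 : (matPolyEquiv _).coeff 1 = !![a, -a ^ 3; 0, -a] := Matrix.ext fun i j => by
    rw [hc]
    fin_cases i <;> fin_cases j <;>
      simp [Polynomial.coeff_one, Polynomial.coeff_X_pow, -map_pow, Polynomial.coeff_C_mul]
  have h2 : (matPolyEquiv _).coeff 2 = !![0, 0; -1, a ^ 2] := Matrix.ext fun i j => by
    rw [hc]
    fin_cases i <;> fin_cases j <;>
      simp [Polynomial.coeff_one, -map_pow, Polynomial.coeff_C_mul]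
  have h3 (n : ℕ) (hn : 2 < n) : (matPolyEquiv _).coeff n = 0 := Matrix.ext fun i j => by
    rw [hc]
    have e1 : n ≠ 0 := by omega
    have e2 : 1 ≠ n := by omega
    have e3 : n ≠ 2 := by omega
    fin_cases i <;> fin_cases j <;>
      simp [Polynomial.coeff_one, Polynomial.coeff_X, Polynomial.coeff_X_pow, -map_pow,
        Polynomial.coeff_C_mul, e1, e2, e3]
  have h2' : (matPolyEquiv _).coeff 2 ≠ 0 := fun h0 => by
    have := congrFun (congrFun (h2.symm.trans h0) 1) 0
    simp at this
  have hd : (matPolyEquiv _).natDegree = 2 :=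
    le_antisymm (Polynomial.natDegree_le_iff_coeff_eq_zero.2 h3)
      (Polynomial.le_natDegree_of_ne_zero h2')
  rcases exists_isReducedProduct hmem with he | ⟨v, hv⟩
  · rw [he, Polynomial.natDegree_one] at hd
    omega
  -- Evaluation at the origin shows that x₂ is not a unit.
  · refine hv.ne_cohn (MvPolynomial.X_ne_zero 2) (fun hu => ?_) hd h1 h2
    have := hu.map (MvPolynomial.aeval (R := k) (0 : Fin 3 → k))
    simp at this

end Anick

end FreePoissonAlgebra

theorem mainTheorem1 (k : Type*) [Field k] :
    ∃ δ : PoissonAlgebra.Aut k (FreePoissonAlgebra k (Fin 3)),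
      (∀ f, δ.1 f = (FreePoissonAlgebra.anick k).toAlgHom f) ∧
      PoissonAlgebra.IsWild k (FreePoissonAlgebra.ι k) δ ∧
      ∃ τ : PoissonAlgebra.Aut k (MvPolynomial (Fin 3) k),
        (∀ f, (FreePoissonAlgebra.toPoly k (Fin 3)).toAlgHom (δ.1 f) =
          τ.1 ((FreePoissonAlgebra.toPoly k (Fin 3)).toAlgHom f)) ∧
        τ.1 (MvPolynomial.X 0) = MvPolynomial.X 0 ∧
        τ.1 (MvPolynomial.X 1) =
          MvPolynomial.X 1 + MvPolynomial.X 0 * MvPolynomial.X 2 ^ 2 ∧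
        τ.1 (MvPolynomial.X 2) = MvPolynomial.X 2 ∧
        τ ∈ PoissonAlgebra.tameAut k (MvPolynomial.X : Fin 3 → MvPolynomial (Fin 3) k) :=
  ⟨FreePoissonAlgebra.anickAut k, FreePoissonAlgebra.anickAut_apply k,
    FreePoissonAlgebra.isWild_anickAut k, FreePoissonAlgebra.anickPolyAut k,
    FreePoissonAlgebra.toPoly_aut_apply _, FreePoissonAlgebra.polyAut_anickAut_X_zero k,
    FreePoissonAlgebra.polyAut_anickAut_X_one k, FreePoissonAlgebra.polyAut_anickAut_X_two k,
    FreePoissonAlgebra.anickPolyAut_mem_tameAut k⟩
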